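/- Let $n\in\mathbb N$, $q_*\in\mathbb R^n$, and consider the fully actuated port-Hamiltonian mechanical system with state $(q,p)\in\mathbb R^n\times\mathbb R^n$ and input $u\in\mathbb R^n$, $$\dot q=\nabla_pH(q,p),\qquad \dot p=-\nabla_qH(q,p)-\mathcal D(q,p)\nabla_pH(q,p)+u,\qquad H(q,p)=\tfrac12p^\top M^{-1}(q)p+V(q),$$ where $M(q)$ is a symmetric positive definite matrix depending on $q$ in a $C^2$ way, $V:\mathbb R^n\to\mathbb R$ is $C^1$, and $\mathcal D(q,p)$ is a diagonal positive semi-definite matrix depending on $(q,p)$ in a locally Lipschitz way. Assume that $\nabla V$ is bounded, $\|\nabla V(q)\|\le C$ for all $q$. Let $\alpha_{c_i},\beta_{c_i}>0$ for $i=1,\dots,n$, let $R_c,K_c\in\mathbb R^{n\times n}$ be symmetric positive definite, and put $$z_c=q-q_*+x_c,\qquad \Phi_c(q,x_c)=\sum_{i=1}^n\frac{\alpha_{c_i}}{\beta_{c_i}}\ln\big(\cosh(\beta_{c_i}z_{c_i})\big).$$ Consider the controller with state $x_c\in\mathbb R^n$, which does not use the velocity or the momentum, $$\dot x_c=-R_c\Big[\sum_{i=1}^n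 e_i\,\alpha_{c_i}\tanh(\beta_{c_i}z_{c_i})+K_cx_c\Big],\qquad u=\nabla V(q)-\nabla_q\Phi_c(q,x_c).$$ Then: (i) the control law is saturated: $|u_i|\le C+\alpha_{c_i}$ for all $(q,x_c)$ and all $i$; (ii) $(q_*,\mathbf 0,\mathbf 0)$ is a globally asymptotically stable equilibrium of the closed-loop system with state $(q,p,x_c)$: it is an equilibrium, every initial state has a unique solution, defined for all $t\ge0$, the equilibrium is Lyapunov stable, and every solution converges to it as $t\to\infty$; (iii) the function $$H_d(q,p,x_c)=\Phi_c(q,x_c)+\tfrac12p^\top M^{-1}(q)p+\tfrac12x_c^\top K_cx_c$$ is a Lyapunov function for this equilibrium: it is $C^1$, vanishes at $(q_*,\mathbf 0,\mathbf 0)$, is positive everywhere else, and its derivative along the closed-loop vector field is nonpositive everywhere. Moreover $H_d$ is radially unbounded, that is, $H_d(q,p,x_c)\to\infty$ as $\|(q,p,x_c)\|\to\infty$. -/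

import Mathlib

noncomputable section

namespace PortHam

/-! ### Autonomous differential equations and Lyapunov stability -/

section Stability

variable {X : Type*} [NormedAddCommGroup X] [NormedSpace ℝ X]

/-- Every initial state has a solution that is defined on all of `[0, ∞)`, and every other solution
with the same initial state, on whatever interval `[0, T)`, is a restriction of it. -/
def IsForwardComplete (f : X → X) : Prop :=
  ∀ x₀ : X, ∃ x : ℝ → X, IsIntegralCurveOn x (fun _ => f) (Set.Ici 0) ∧ x 0 = x₀ ∧
    ∀ T : ℝ, 0 < T → ∀ y : ℝ → X, IsIntegralCurveOn y (fun _ => f) (Set.Ico 0 T) → y 0 = x₀ →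
      Set.EqOn y x (Set.Ico 0 T)

/-- `a` is stable in the sense of Lyapunov for `x' = f x`. -/
def IsLyapunovStable (f : X → X) (a : X) : Prop :=
  ∀ ε : ℝ, 0 < ε → ∃ δ : ℝ, 0 < δ ∧ ∀ x : ℝ → X, IsIntegralCurveOn x (fun _ => f) (Set.Ici 0) →
    ‖x 0 - a‖ < δ → ∀ t : ℝ, 0 ≤ t → ‖x t - a‖ < ε

/-- Every solution of `x' = f x` converges to `a` as time goes to infinity. -/
def IsGloballyAttractive (f : X → X) (a : X) : Prop :=
  ∀ x : ℝ → X, IsIntegralCurveOn x (fun _ => f) (Set.Ici 0) → Filter.Tendsto x Filter.atTop (nhds a)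

/-- `a` is a globally asymptotically stable equilibrium of `x' = f x`: it is an equilibrium, the
solutions exist for all positive times and are unique, `a` is Lyapunov stable, and every solution
converges to `a`. -/
structure IsGloballyAsymptoticallyStable (f : X → X) (a : X) : Prop where
  equilibrium : f a = 0
  forwardComplete : IsForwardComplete f
  stable : IsLyapunovStable f a
  attractive : IsGloballyAttractive f a

/-- `W` is a (global, weak) Lyapunov function for the equilibrium `a` of `x' = f x`: continuously
differentiable, positive definite with respect to `a`, and with nonpositive derivative along the
vector field. -/
structure IsLyapunovFunction (f : X → X) (a : X) (W : X → ℝ) : Prop where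
  contDiff : ContDiff ℝ 1 W
  zero_at : W a = 0
  pos_of_ne : ∀ x, x ≠ a → 0 < W x
  deriv_nonpos : ∀ x, fderiv ℝ W x (f x) ≤ 0

/-- `W x → ∞` as `‖x‖ → ∞`. -/
def IsRadiallyUnbounded (W : X → ℝ) : Prop :=
  Filter.Tendsto W (Bornology.cobounded X) Filter.atTop

end Stability

/-! ### Port-Hamiltonian mechanical systems -/

/-- `ℝⁿ` with its Euclidean inner product. -/
abbrev Vec (n : ℕ) : Type := EuclideanSpace ℝ (Fin n)

/-- The kinetic energy `½ pᵀ M(q)⁻¹ p`. -/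
def kinetic {n : ℕ} (M : Vec n → Matrix (Fin n) (Fin n) ℝ) (q p : Vec n) : ℝ :=
  1 / 2 * inner ℝ p (Matrix.toEuclideanLin (M q)⁻¹ p)

/-- The Hamiltonian `H(q, p) = ½ pᵀ M(q)⁻¹ p + V(q)`. -/
def hamiltonian {n : ℕ} (M : Vec n → Matrix (Fin n) (Fin n) ℝ) (V : Vec n → ℝ) (q p : Vec n) : ℝ :=
  kinetic M q p + V q

/-- Right-hand side of the mechanical system with input `u` in port-Hamiltonian form,
`q' = ∇_p H`, `p' = -∇_q H - 𝒟(q, p) ∇_p H + G u`. -/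
def mechField {n m : ℕ} (M : Vec n → Matrix (Fin n) (Fin n) ℝ) (V : Vec n → ℝ)
    (D : Vec n → Vec n → Matrix (Fin n) (Fin n) ℝ) (G : Matrix (Fin n) (Fin m) ℝ)
    (q p : Vec n) (u : Vec m) : Vec n × Vec n :=
  (gradient (fun p' => hamiltonian M V q p') p,
   -gradient (fun q' => hamiltonian M V q' p) q
     - Matrix.toEuclideanLin (D q p) (gradient (fun p' => hamiltonian M V q p') p) + Matrix.toEuclideanLin G u)

/-! ### The controller, for `γ(q) = q` -/

/-- `z_c = q - q_* + x_c`. -/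
def zc {n : ℕ} (qs q xc : Vec n) : Vec n := q - qs + xc

/-- `Φ_c = ∑ᵢ (αᵢ / βᵢ) ln (cosh (βᵢ z_{c,i}))`. -/
def Phic {n : ℕ} (α β : Fin n → ℝ) (qs q xc : Vec n) : ℝ :=
  ∑ i, α i / β i * Real.log (Real.cosh (β i * zc qs q xc i))

/-- Right-hand side of the controller dynamics,
`x_c' = -R_c (∑ᵢ eᵢ αᵢ tanh (βᵢ z_{c,i}) + K_c x_c)`. -/
def ctrlField {n : ℕ} (α β : Fin n → ℝ) (Rc Kc : Matrix (Fin n) (Fin n) ℝ)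
    (qs q xc : Vec n) : Vec n :=
  -Matrix.toEuclideanLin Rc (WithLp.toLp 2 (fun i => α i * Real.tanh (β i * zc qs q xc i)) + Matrix.toEuclideanLin Kc xc)

/-- The control law `u = ∇V(q) - ∇_q Φ_c(q, x_c)`; it does not depend on `p`. -/
def ctrlLaw {n : ℕ} (V : Vec n → ℝ) (α β : Fin n → ℝ) (qs q xc : Vec n) : Vec n :=
  gradient V q - gradient (fun q' => Phic α β qs q' xc) q

/-- The closed-loop vector field on the states `(q, p, x_c)`: the fully actuated system (`G = Iₙ`)
under the control law, together with the controller dynamics. -/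
def closedLoop {n : ℕ} (M : Vec n → Matrix (Fin n) (Fin n) ℝ) (V : Vec n → ℝ)
    (D : Vec n → Vec n → Matrix (Fin n) (Fin n) ℝ) (α β : Fin n → ℝ)
    (Rc Kc : Matrix (Fin n) (Fin n) ℝ) (qs : Vec n) (s : Vec n × Vec n × Vec n) :
    Vec n × Vec n × Vec n :=
  ((mechField M V D 1 s.1 s.2.1 (ctrlLaw V α β qs s.1 s.2.2)).1,
   (mechField M V D 1 s.1 s.2.1 (ctrlLaw V α β qs s.1 s.2.2)).2,
   ctrlField α β Rc Kc qs s.1 s.2.2)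

/-- `H_d(q, p, x_c) = Φ_c(q, x_c) + ½ pᵀ M(q)⁻¹ p + ½ x_cᵀ K_c x_c`. -/
def Hd {n : ℕ} (M : Vec n → Matrix (Fin n) (Fin n) ℝ) (α β : Fin n → ℝ)
    (Kc : Matrix (Fin n) (Fin n) ℝ) (qs : Vec n) (s : Vec n × Vec n × Vec n) : ℝ :=
  Phic α β qs s.1 s.2.2 + kinetic M s.1 s.2.1 + 1 / 2 * inner ℝ s.2.2 (Matrix.toEuclideanLin Kc s.2.2)

end PortHam

end

/-! The term `∇V` in the control law cancels the potential force, and `-∇_q Φ_c` acts as a spring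
with bounded force `α tanh(β z_c)`, which gives the saturation bound. The closed loop is then a
dissipative Hamiltonian system with energy `H_d`: the exchange terms between `q`, `p` and `x_c`
cancel, and what remains (`fderiv_Hd_closedLoop`) is `H_d' = -wᵀ R_c w - vᵀ 𝒟 v ≤ 0`, where `v = M⁻¹
p` and `w = tanhVec + K_c x_c` is `ctrlForce`.

Since `H_d` is radially unbounded (`isRadiallyUnbounded_Hd`), its sublevel sets are compact and
forward invariant. With a locally Lipschitz field this gives global existence, uniqueness and
Lyapunov stability.

The derivative of `H_d` is only semidefinite, so convergence needs LaSalle's principle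
(`isGloballyAsymptoticallyStable_of_laSalle`). If `H_d` is constant along a solution, then `w = 0`,
because `R_c` is positive definite. Hence `x_c` is constant, so `tanhVec` is constant, so `q` is
constant by injectivity of `tanh`, so `p = 0`. The momentum equation then gives `tanhVec = 0`, and
therefore `x_c = 0` and `q = q_*` (`eq_equilibrium_of_Hd_const`). Damping thus enters only through
the controller state, and `𝒟` may vanish. -/

namespace PortHam

open Set Filter Topology Metric

/-! ### Flows with a proper Lyapunov function: existence, uniqueness, stability, LaSalle. -/

section Dynamics

variable {X : Type*} [NormedAddCommGroup X] [NormedSpace ℝ X]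

/-- A function whose derivative along `f` is nonpositive decreases along the solutions. -/
lemma antitoneOn_comp_integralCurve {f : X → X} {W : X → ℝ} (hW : ContDiff ℝ 1 W)
    (hWf : ∀ x, fderiv ℝ W x (f x) ≤ 0) {s : Set ℝ} (hs : Convex ℝ s) {x : ℝ → X}
    (hx : IsIntegralCurveOn x (fun _ => f) s) : AntitoneOn (fun t => W (x t)) s := by
  have hd : ∀ t ∈ interior s, HasDerivAt (fun t => W (x t)) (fderiv ℝ W (x t) (f (x t))) t := by
    intro t ht
    exact ((hW.differentiable (by simp)) (x t)).hasFDerivAt.comp_hasDerivAt t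
      ((hx t (interior_subset ht)).hasDerivAt (mem_interior_iff_mem_nhds.1 ht))
  refine antitoneOn_of_deriv_nonpos hs (hW.continuous.comp_continuousOn hx.continuousOn)
    (fun t ht => (hd t ht).differentiableAt.differentiableWithinAt) fun t ht => ?_
  rw [(hd t ht).deriv]
  exact hWf _

/-- The sublevel sets of a continuous radially unbounded function are compact. -/
lemma IsRadiallyUnbounded.isCompact_sublevel {Y : Type*} [NormedAddCommGroup Y] [ProperSpace Y]
    {W : Y → ℝ} (hW : IsRadiallyUnbounded W) (hc : Continuous W) (c : ℝ) :
    IsCompact {x | W x ≤ c} := by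
  refine isCompact_of_isClosed_isBounded (isClosed_le hc continuous_const) ?_
  have h : {x | W x ≤ c}ᶜ ∈ Bornology.cobounded Y := by
    filter_upwards [hW.eventually_gt_atTop c] with x hx
    simpa using hx
  rwa [← Bornology.isBounded_def] at h

/-- Grönwall's inequality is stated with right derivatives, that is, within `Ici t`. -/
lemma hasDerivWithinAt_Ici_of_Ico {f : X → X} {x : ℝ → X} {T t : ℝ}
    (hx : IsIntegralCurveOn x (fun _ => f) (Ico 0 T)) (ht : t ∈ Ico 0 T) :
    HasDerivWithinAt x (f (x t)) (Ici t) t := by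
  refine (hx t ht).mono_of_mem_nhdsWithin ?_
  filter_upwards [Ico_mem_nhdsGE ht.2] with s hs
  exact ⟨ht.1.trans hs.1, hs.2⟩

/-- Grönwall's estimate for two solutions that stay in a compact set. -/
lemma dist_integralCurve_le {f : X → X} {K : NNReal} {S : Set X} (hf : LipschitzOnWith K f S)
    {T : ℝ} {x y : ℝ → X} (hx : IsIntegralCurveOn x (fun _ => f) (Ico 0 T))
    (hy : IsIntegralCurveOn y (fun _ => f) (Ico 0 T)) (hxS : ∀ t ∈ Ico 0 T, x t ∈ S)
    (hyS : ∀ t ∈ Ico 0 T, y t ∈ S) {t : ℝ} (ht : t ∈ Ico 0 T) :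
    dist (x t) (y t) ≤ dist (x 0) (y 0) * Real.exp (K * t) := by
  have hsub : ∀ s, s ∈ Icc 0 t → s ∈ Ico 0 T := fun s hs => ⟨hs.1, hs.2.trans_lt ht.2⟩
  have hsub' : ∀ s, s ∈ Ico 0 t → s ∈ Ico 0 T := fun s hs => hsub s (Ico_subset_Icc_self hs)
  have h := dist_le_of_trajectories_ODE_of_mem (v := fun _ => f) (s := fun _ => S) (K := K)
    (f := x) (g := y) (a := 0) (b := t) (δ := dist (x 0) (y 0)) (fun _ _ => hf)
    (hx.continuousOn.mono hsub) (fun s hs => hasDerivWithinAt_Ici_of_Ico hx (hsub' s hs))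
    (fun s hs => hxS s (hsub' s hs))
    (hy.continuousOn.mono hsub) (fun s hs => hasDerivWithinAt_Ici_of_Ico hy (hsub' s hs))
    (fun s hs => hyS s (hsub' s hs)) le_rfl t ⟨ht.1, le_rfl⟩
  simpa using h

lemma integralCurve_mem_sublevel {f : X → X} {W : X → ℝ} (hW : ContDiff ℝ 1 W)
    (hWf : ∀ x, fderiv ℝ W x (f x) ≤ 0) {T : ℝ} {x : ℝ → X} {c : ℝ}
    (hx : IsIntegralCurveOn x (fun _ => f) (Ico 0 T)) (h0 : W (x 0) ≤ c) :
    ∀ t ∈ Ico 0 T, x t ∈ {x | W x ≤ c} := fun _ ht =>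
  (antitoneOn_comp_integralCurve hW hWf (convex_Ico 0 T) hx
    ⟨le_rfl, ht.1.trans_lt ht.2⟩ ht ht.1).trans h0

/-- Uniqueness of solutions, given a proper function that decreases along them. -/
lemma eqOn_integralCurve [ProperSpace X] {f : X → X} (hf : LocallyLipschitz f) {W : X → ℝ}
    (hW : ContDiff ℝ 1 W) (hWf : ∀ x, fderiv ℝ W x (f x) ≤ 0) (hr : IsRadiallyUnbounded W)
    {T : ℝ} {x y : ℝ → X} (hx : IsIntegralCurveOn x (fun _ => f) (Ico 0 T))
    (hy : IsIntegralCurveOn y (fun _ => f) (Ico 0 T)) (h0 : x 0 = y 0) :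
    EqOn x y (Ico 0 T) := by
  obtain ⟨K, hK⟩ := LocallyLipschitzOn.exists_lipschitzOnWith_of_compact
    (s := {z | W z ≤ W (x 0)}) (hr.isCompact_sublevel hW.continuous _) hf.locallyLipschitzOn
  intro t ht
  have h := dist_integralCurve_le hK hx hy (integralCurve_mem_sublevel hW hWf hx le_rfl)
    (integralCurve_mem_sublevel hW hWf hy (by rw [h0])) ht
  rw [h0, dist_self, zero_mul] at h
  exact dist_le_zero.1 h

/-- A bounded locally Lipschitz field has solutions on every compact interval `[0, T]`. -/
lemma exists_integralCurve_Icc_of_bounded [FiniteDimensional ℝ X] {g : X → X}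
    (hg : LocallyLipschitz g) {L : ℝ} (hL : ∀ x, ‖g x‖ ≤ L) (x₀ : X) {T : ℝ} (hT : 0 ≤ T) :
    ∃ x : ℝ → X, x 0 = x₀ ∧ IsIntegralCurveOn x (fun _ => g) (Icc 0 T) := by
  have : ProperSpace X := FiniteDimensional.proper ℝ X
  have hL0 : 0 ≤ L := (norm_nonneg _).trans (hL x₀)
  lift L to NNReal using hL0
  lift T to NNReal using hT
  -- At speed at most `L`, a curve cannot leave the ball of radius `L * T` within time `T`.
  obtain ⟨K, hK⟩ := LocallyLipschitzOn.exists_lipschitzOnWith_of_compact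
    (isCompact_closedBall x₀ (L * T : NNReal)) hg.locallyLipschitzOn
  have hp : IsPicardLindelof (fun _ => g) (tmin := 0) (tmax := T) ⟨0, le_rfl, T.2⟩ x₀ (L * T) 0 L K :=
    IsPicardLindelof.of_time_independent (fun x _ => hL x) hK (by simp)
  obtain ⟨x, hx0, hx⟩ := hp.exists_eq_forall_mem_Icc_hasDerivWithinAt₀
  exact ⟨x, hx0, hx⟩

lemma LocallyLipschitz.smul {Y : Type*} [PseudoEMetricSpace Y] {c : Y → ℝ} {f : Y → X}
    (hc : LocallyLipschitz c) (hf : LocallyLipschitz f) : LocallyLipschitz fun y => c y • f y := by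
  have h : ContDiff ℝ 1 fun p : ℝ × X => p.1 • p.2 := contDiff_fst.smul contDiff_snd
  exact h.locallyLipschitz.comp (hc.prodMk hf)

/-- A solution on `[0, T]` exists as soon as a proper function decreases along the field. -/
lemma exists_integralCurve_Icc [FiniteDimensional ℝ X] {f : X → X}
    (hf : LocallyLipschitz f) {W : X → ℝ} (hW : ContDiff ℝ 1 W)
    (hWf : ∀ x, fderiv ℝ W x (f x) ≤ 0) (hr : IsRadiallyUnbounded W) (x₀ : X) {T : ℝ}
    (hT : 0 ≤ T) : ∃ x : ℝ → X, x 0 = x₀ ∧ IsIntegralCurveOn x (fun _ => f) (Icc 0 T) := by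
  have : ProperSpace X := FiniteDimensional.proper ℝ X
  obtain ⟨R, hR⟩ := (hr.isCompact_sublevel hW.continuous (W x₀)).isBounded.exists_norm_le
  -- The cutoff is `1` on a ball containing the sublevel set of `x₀` and `0` beyond radius `R + 1`,
  -- so `χ • f` is bounded. As `χ ≥ 0`, `W` still decreases along `χ • f`; its solution stays where
  -- `χ = 1` and therefore solves the original equation.
  set χ : X → ℝ := fun x => max 0 (1 - max 0 (‖x‖ - R)) with hχ
  have hχ0 : ∀ x, 0 ≤ χ x := fun x => le_max_left _ _
  have hχ1 : ∀ x, ‖x‖ ≤ R → χ x = 1 := fun x hx => by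
    simp [hχ, max_eq_left (sub_nonpos.2 hx)]
  have hχ2 : ∀ x, R + 1 ≤ ‖x‖ → χ x = 0 := fun x hx => by
    refine max_eq_left ?_
    have := le_max_right 0 (‖x‖ - R)
    linarith
  have hn : LocallyLipschitz fun x : X => ‖x‖ := (lipschitzWith_one_norm (E := X)).locallyLipschitz
  have hχL : LocallyLipschitz χ :=
    (((LocallyLipschitz.const (1 : ℝ)).sub
      ((hn.sub (LocallyLipschitz.const R)).const_max 0)).const_max 0)
  have hgL : LocallyLipschitz fun x => χ x • f x := LocallyLipschitz.smul hχL hf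
  obtain ⟨L, hL⟩ := (isCompact_closedBall (0 : X) (R + 1)).exists_bound_of_continuousOn
    hgL.continuous.continuousOn
  obtain ⟨x, hx0, hx⟩ := exists_integralCurve_Icc_of_bounded hgL (L := max L 0) (fun x => by
    by_cases h : ‖x‖ ≤ R + 1
    · exact (hL x (by simpa using h)).trans (le_max_left _ _)
    · simp [hχ2 x (le_of_not_ge h)]) x₀ hT
  refine ⟨x, hx0, fun t ht => ?_⟩
  have hWx : W (x t) ≤ W (x 0) := antitoneOn_comp_integralCurve hW (fun y => by
    rw [map_smul, smul_eq_mul]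
    exact mul_nonpos_of_nonneg_of_nonpos (hχ0 y) (hWf y)) (convex_Icc 0 T) hx ⟨le_rfl, hT⟩ ht ht.1
  have h := hx t ht
  simp only [hχ1 (x t) (hR _ (by simpa [hx0] using hWx)), one_smul] at h
  exact h

/-- Solutions on the intervals `[0, T]` agree on overlaps by uniqueness, so the diagonal `t ↦ x (t +
1) t` is a global solution; the extra unit of time keeps `t` away from the right endpoint. -/
theorem isForwardComplete_of_proper [FiniteDimensional ℝ X] {f : X → X}
    (hf : LocallyLipschitz f) {W : X → ℝ} (hW : ContDiff ℝ 1 W)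
    (hWf : ∀ x, fderiv ℝ W x (f x) ≤ 0) (hr : IsRadiallyUnbounded W) : IsForwardComplete f := by
  have : ProperSpace X := FiniteDimensional.proper ℝ X
  intro x₀
  have hex : ∀ T : ℝ, ∃ x : ℝ → X, x 0 = x₀ ∧
      (0 ≤ T → IsIntegralCurveOn x (fun _ => f) (Icc 0 T)) := fun T => by
    by_cases hT : 0 ≤ T
    · obtain ⟨x, h0, h⟩ := exists_integralCurve_Icc hf hW hWf hr x₀ hT
      exact ⟨x, h0, fun _ => h⟩
    · exact ⟨fun _ => x₀, rfl, fun h => absurd h hT⟩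
  choose x hx0 hx using hex
  have heq : ∀ S t : ℝ, 0 ≤ t → t < S → x (t + 1) t = x S t := fun S t ht hS => by
    refine eqOn_integralCurve hf hW hWf hr (T := min (t + 1) S)
      ((hx (t + 1) (by linarith)).mono fun s hs => ⟨hs.1, (hs.2.trans_le (min_le_left _ _)).le⟩)
      ((hx S (by linarith)).mono fun s hs => ⟨hs.1, (hs.2.trans_le (min_le_right _ _)).le⟩)
      (by rw [hx0, hx0]) ⟨ht, lt_min (by linarith) hS⟩
  have hcurve : IsIntegralCurveOn (fun t => x (t + 1) t) (fun _ => f) (Ici 0) := by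
    intro t ht
    have ht' : (0 : ℝ) ≤ t := ht
    have h1 : HasDerivWithinAt (x (t + 1)) (f (x (t + 1) t)) (Ici 0) t := by
      refine (hx (t + 1) (by linarith) t ⟨ht, by linarith⟩).mono_of_mem_nhdsWithin ?_
      filter_upwards [self_mem_nhdsWithin, mem_nhdsWithin_of_mem_nhds (Iio_mem_nhds (lt_add_one t))]
        with s hs hs' using ⟨hs, le_of_lt hs'⟩
    refine h1.congr_of_eventuallyEq ?_ rfl
    filter_upwards [self_mem_nhdsWithin, mem_nhdsWithin_of_mem_nhds (Iio_mem_nhds (lt_add_one t))]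
      with s hs hs' using heq _ s hs hs'
  refine ⟨_, hcurve, hx0 _, fun T _ y hy hy0 => ?_⟩
  exact eqOn_integralCurve hf hW hWf hr hy (hcurve.mono fun s hs => hs.1) (by rw [hy0, hx0])

/-- On the compact set where `W ≤ 1` and `ε ≤ ‖x - a‖`, `W` has a positive minimum. Below that value
and below `1`, a sublevel set lies in the `ε`-ball, and solutions cannot leave it. -/
theorem isLyapunovStable_of_proper [ProperSpace X] {f : X → X} {a : X} {W : X → ℝ}
    (hW : IsLyapunovFunction f a W) (hr : IsRadiallyUnbounded W) : IsLyapunovStable f a := by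
  intro ε hε
  have hc := hW.contDiff.continuous
  obtain ⟨c, hc0, hcε⟩ : ∃ c, 0 < c ∧ ∀ x, W x < c → ‖x - a‖ < ε := by
    have hS : IsCompact ({x | W x ≤ 1} ∩ {x | ε ≤ ‖x - a‖}) :=
      (hr.isCompact_sublevel hc 1).inter_right
        (isClosed_le continuous_const (by fun_prop))
    rcases ({x | W x ≤ 1} ∩ {x | ε ≤ ‖x - a‖}).eq_empty_or_nonempty with h | h
    · refine ⟨1, one_pos, fun x hx => lt_of_not_ge fun hx' => ?_⟩
      exact (h ▸ (⟨hx.le, hx'⟩ : x ∈ {x | W x ≤ 1} ∩ {x | ε ≤ ‖x - a‖}) : x ∈ (∅ : Set X))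
    · obtain ⟨m, hm, hmin⟩ := hS.exists_isMinOn h hc.continuousOn
      have hma : m ≠ a := fun h => by
        have := hm.2
        simp only [mem_ofPred_eq, h, sub_self, norm_zero] at this
        linarith
      refine ⟨min 1 (W m), lt_min one_pos (hW.pos_of_ne m hma), fun x hx => lt_of_not_ge fun hx' => ?_⟩
      have h1 : W m ≤ W x := hmin (⟨(hx.trans_le (min_le_left _ _)).le, hx'⟩ :
        x ∈ {x | W x ≤ 1} ∩ {x | ε ≤ ‖x - a‖})
      exact (hx.trans_le (min_le_right _ _)).not_ge h1
  obtain ⟨δ, hδ, h⟩ := Metric.continuousAt_iff.1 (hc.continuousAt (x := a)) c hc0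
  refine ⟨δ, hδ, fun x hx hx0 t ht => hcε _ ?_⟩
  have h1 := h (by rwa [dist_eq_norm] : dist (x 0) a < δ)
  rw [hW.zero_at, Real.dist_eq, sub_zero] at h1
  exact ((antitoneOn_comp_integralCurve hW.contDiff hW.deriv_nonpos (convex_Ici 0) hx self_mem_Ici
    (show t ∈ Ici 0 from ht) ht).trans (le_abs_self _)).trans_lt h1

/-- Solutions through the limit points of a solution consist of limit points of that solution. -/
lemma mapClusterPt_integralCurve [ProperSpace X] {f : X → X} (hf : LocallyLipschitz f)
    {W : X → ℝ} (hW : ContDiff ℝ 1 W) (hWf : ∀ x, fderiv ℝ W x (f x) ≤ 0)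
    (hr : IsRadiallyUnbounded W) {x y : ℝ → X} (hx : IsIntegralCurveOn x (fun _ => f) (Ici 0))
    (hy : IsIntegralCurveOn y (fun _ => f) (Ici 0)) (hb : MapClusterPt (y 0) atTop x)
    {s : ℝ} (hs : 0 ≤ s) : MapClusterPt (y s) atTop x := by
  -- This sublevel set contains both forward orbits, so `K` serves all time translates of `x` at
  -- once.
  obtain ⟨K, hK⟩ := LocallyLipschitzOn.exists_lipschitzOnWith_of_compact
    (s := {z | W z ≤ max (W (x 0)) (W (y 0))}) (hr.isCompact_sublevel hW.continuous _) hf.locallyLipschitzOn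
  have hIco : ∀ T : ℝ, Ico 0 T ⊆ Ici 0 := fun T t ht => ht.1
  have key : ∀ t, 0 ≤ t → dist (x (t + s)) (y s) ≤ dist (x t) (y 0) * Real.exp (K * s) := by
    intro t ht
    have hz : IsIntegralCurveOn (fun r => x (r + t)) (fun _ => f) (Ici 0) := by
      refine (hx.comp_add t).mono fun r hr => ?_
      rw [Set.mem_vadd_set_iff_neg_vadd_mem]
      simp only [neg_neg, vadd_eq_add, mem_Ici] at *
      linarith
    have h := dist_integralCurve_le hK (hz.mono (hIco (s + 1))) (hy.mono (hIco (s + 1)))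
      (integralCurve_mem_sublevel hW hWf (hz.mono (hIco _)) ?_)
      (integralCurve_mem_sublevel hW hWf (hy.mono (hIco _)) (le_max_right _ _))
      (t := s) ⟨hs, by linarith⟩
    · simpa [add_comm] using h
    · refine le_trans ?_ (le_max_left _ _)
      simpa using antitoneOn_comp_integralCurve hW hWf (convex_Ici 0) hx self_mem_Ici
        (show t ∈ Ici 0 from ht) ht
  rw [mapClusterPt_iff_frequently] at hb ⊢
  intro U hU
  obtain ⟨ε, hε, hεU⟩ := Metric.mem_nhds_iff.1 hU
  have hδ : 0 < ε / Real.exp (K * s) := by positivity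
  rw [frequently_atTop]
  intro N
  obtain ⟨t, htN, ht⟩ := (frequently_atTop.1 (hb _ (Metric.ball_mem_nhds _ hδ))) (max N 0)
  refine ⟨t + s, by linarith [le_max_left N 0], hεU ?_⟩
  have h0 : 0 ≤ t := (le_max_right N 0).trans htN
  exact (key t h0).trans_lt ((lt_div_iff₀ (Real.exp_pos _)).1 ht)

/-- **LaSalle's invariance principle**, for a proper Lyapunov function that is constant along no
solution except the equilibrium. -/
theorem isGloballyAsymptoticallyStable_of_laSalle [FiniteDimensional ℝ X] {f : X → X} {a : X}
    {W : X → ℝ} (hf : LocallyLipschitz f) (ha : f a = 0) (hW : IsLyapunovFunction f a W)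
    (hr : IsRadiallyUnbounded W)
    (hinv : ∀ y : ℝ → X, IsIntegralCurveOn y (fun _ => f) (Ici 0) →
      (∀ t, 0 ≤ t → W (y t) = W (y 0)) → y 0 = a) :
    IsGloballyAsymptoticallyStable f a := by
  have : ProperSpace X := FiniteDimensional.proper ℝ X
  have hfc := isForwardComplete_of_proper hf hW.contDiff hW.deriv_nonpos hr
  refine ⟨ha, hfc, isLyapunovStable_of_proper hW hr, fun x hx => ?_⟩
  have hanti := antitoneOn_comp_integralCurve hW.contDiff hW.deriv_nonpos (convex_Ici 0) hx
  have hnonneg : ∀ z, 0 ≤ W z := fun z => by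
    by_cases hz : z = a
    · rw [hz, hW.zero_at]
    · exact (hW.pos_of_ne z hz).le
  obtain ⟨c, hc⟩ : ∃ c, Tendsto (fun t => W (x t)) atTop (𝓝 c) := by
    -- Freezing the time at `0` for negative `t` extends the monotonicity from `[0, ∞)` to `ℝ`.
    have hmono : Antitone fun t => W (x (max t 0)) := fun s t hst =>
      hanti (le_max_right s 0) (le_max_right t 0) (max_le_max_right 0 hst)
    have h := tendsto_atTop_ciInf hmono ⟨0, by rintro _ ⟨t, rfl⟩; exact hnonneg _⟩
    refine ⟨_, h.congr' ?_⟩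
    filter_upwards [eventually_ge_atTop 0] with t ht
    rw [max_eq_left ht]
  have hlim : ∀ z, MapClusterPt z atTop x → W z = c := fun z hz =>
    eq_of_nhds_neBot <| (hz.continuousAt_comp hW.contDiff.continuous.continuousAt).neBot.mono
      (inf_le_inf_left _ hc)
  -- A curve in a compact set converges once `a` is its only cluster point. The solution from a
  -- cluster point `b` consists of cluster points, on which `W = c`, so `hinv` gives `b = a`.
  refine (hr.isCompact_sublevel hW.contDiff.continuous (W (x 0))).tendsto_nhds_of_unique_mapClusterPt
    ?_ fun b _ hb => ?_
  · filter_upwards [eventually_ge_atTop 0] with t ht using hanti self_mem_Ici ht ht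
  · obtain ⟨y, hy, hy0, -⟩ := hfc b
    rw [← hy0] at hb ⊢
    refine hinv y hy fun t ht => ?_
    rw [hlim _ hb, hlim _ (mapClusterPt_integralCurve hf hW.contDiff hW.deriv_nonpos hr hx hy hb ht)]

end Dynamics

end PortHam

namespace PortHam

open Set Filter Topology Metric Matrix

/-! ### Regularity and positivity of matrix-valued functions. -/

section MatrixFields

variable {E : Type*} [NormedAddCommGroup E] [NormedSpace ℝ E] {n m : ℕ}

lemma contDiff_matrix_det {r : WithTop ℕ∞} {A : E → Matrix (Fin n) (Fin n) ℝ}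
    (hA : ∀ i j, ContDiff ℝ r fun x => A x i j) : ContDiff ℝ r fun x => (A x).det := by
  simp only [Matrix.det_apply']
  exact ContDiff.sum fun σ _ => contDiff_const.mul (contDiff_prod fun i _ => hA _ _)

/-- By Cramer's rule, the entries are determinants divided by a nonvanishing determinant. -/
lemma contDiff_matrix_inv {r : WithTop ℕ∞} {A : E → Matrix (Fin n) (Fin n) ℝ}
    (hA : ∀ i j, ContDiff ℝ r fun x => A x i j) (hdet : ∀ x, (A x).det ≠ 0) (i j : Fin n) :
    ContDiff ℝ r fun x => (A x)⁻¹ i j := by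
  simp only [Matrix.inv_def, Ring.inverse_eq_inv', Matrix.smul_apply, smul_eq_mul,
    Matrix.adjugate_apply]
  refine ((contDiff_matrix_det hA).inv hdet).mul (contDiff_matrix_det fun k l => ?_)
  by_cases h : k = j
  · subst h
    simpa using contDiff_const
  · simpa [Matrix.updateRow_ne h] using hA k l

lemma toEuclideanLin_apply_apply (A : Matrix (Fin m) (Fin n) ℝ) (v : Vec n) (i : Fin m) :
    toEuclideanLin A v i = ∑ j, A i j * v j := rfl

lemma contDiff_toEuclideanLin {r : WithTop ℕ∞} {A : E → Matrix (Fin m) (Fin n) ℝ} {v : E → Vec n}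
    (hA : ∀ i j, ContDiff ℝ r fun x => A x i j) (hv : ContDiff ℝ r v) :
    ContDiff ℝ r fun x => toEuclideanLin (A x) (v x) := by
  refine contDiff_euclidean.2 fun i => ?_
  simp only [toEuclideanLin_apply_apply]
  exact ContDiff.sum fun j _ => (hA i j).mul (contDiff_euclidean.1 hv j)

lemma LocallyLipschitz.sum {ι Y : Type*} [PseudoEMetricSpace Y] {F : ι → Y → Vec m} (s : Finset ι)
    (hF : ∀ i ∈ s, LocallyLipschitz (F i)) : LocallyLipschitz fun x => ∑ i ∈ s, F i x := by
  classical
  induction s using Finset.induction_on with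
  | empty => simpa using LocallyLipschitz.const (0 : Vec m)
  | insert i s his ih =>
    simp only [Finset.sum_insert his]
    exact (hF i (Finset.mem_insert_self _ _)).add
      (ih fun j hj => hF j (Finset.mem_insert_of_mem hj))

lemma locallyLipschitz_toEuclideanLin {Y : Type*} [PseudoEMetricSpace Y]
    {A : Y → Matrix (Fin m) (Fin n) ℝ} {v : Y → Vec n}
    (hA : ∀ i j, LocallyLipschitz fun x => A x i j) (hv : LocallyLipschitz v) :
    LocallyLipschitz fun x => toEuclideanLin (A x) (v x) := by
  have h : (fun x => toEuclideanLin (A x) (v x)) = fun x => ∑ i, ∑ j,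
      A x i j • (v x j • EuclideanSpace.single i (1 : ℝ)) := by
    ext x k
    simp only [toEuclideanLin_apply_apply, WithLp.ofLp_sum, Finset.sum_apply, PiLp.smul_apply,
      PiLp.single_apply, smul_eq_mul]
    simp
  rw [h]
  refine LocallyLipschitz.sum _ fun i _ => LocallyLipschitz.sum _ fun j _ =>
    LocallyLipschitz.smul (hA i j) ?_
  have hj : ContDiff ℝ 1 fun w : Vec n => w j := contDiff_euclidean.1 contDiff_id j
  exact LocallyLipschitz.smul (hj.locallyLipschitz.comp hv) (LocallyLipschitz.const _)

lemma inner_toEuclideanLin_comm {A : Matrix (Fin n) (Fin n) ℝ} (hA : A.IsHermitian) (v w : Vec n) :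
    inner ℝ (toEuclideanLin A v) w = inner ℝ v (toEuclideanLin A w) :=
  isSymmetric_toEuclideanLin_iff.2 hA v w

lemma inner_toEuclideanLin_self_nonneg {A : Matrix (Fin n) (Fin n) ℝ} (hA : A.PosSemidef)
    (v : Vec n) : 0 ≤ inner ℝ v (toEuclideanLin A v) := by
  have h := hA.dotProduct_mulVec_nonneg v.ofLp
  rw [dotProduct_comm] at h
  exact h

lemma inner_toEuclideanLin_self_pos {A : Matrix (Fin n) (Fin n) ℝ} (hA : A.PosDef)
    {v : Vec n} (hv : v ≠ 0) : 0 < inner ℝ v (toEuclideanLin A v) := by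
  have h := hA.dotProduct_mulVec_pos (x := v.ofLp) (by simpa using hv)
  rw [dotProduct_comm] at h
  exact h

lemma eq_zero_of_toEuclideanLin_eq_zero {A : Matrix (Fin n) (Fin n) ℝ} (hA : A.PosDef)
    {v : Vec n} (h : toEuclideanLin A v = 0) : v = 0 := by
  by_contra hv
  have := inner_toEuclideanLin_self_pos hA hv
  rw [h, inner_zero_right] at this
  exact this.false

/-- A continuous field of positive definite matrices is uniformly positive definite on compacts. -/
lemma exists_forall_le_inner_toEuclideanLin {A : E → Matrix (Fin n) (Fin n) ℝ}
    (hA : ∀ x, (A x).PosDef) (hc : ∀ i j, ContDiff ℝ 0 fun x => A x i j) {S : Set E}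
    (hS : IsCompact S) :
    ∃ c, 0 < c ∧ ∀ x ∈ S, ∀ v : Vec n, c * ‖v‖ ^ 2 ≤ inner ℝ v (toEuclideanLin (A x) v) := by
  have hcont : Continuous fun y : E × Vec n => inner ℝ y.2 (toEuclideanLin (A y.1) y.2) :=
    continuous_snd.inner (contDiff_toEuclideanLin (r := 0)
      (fun i j => (hc i j).comp contDiff_fst) contDiff_snd).continuous
  -- By homogeneity in `v` it is enough to minimize over unit vectors. The product is empty if `S`
  -- is empty or `n = 0`.
  have hT : IsCompact (S ×ˢ sphere (0 : Vec n) 1) := hS.prod (isCompact_sphere _ _)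
  obtain ⟨c, hc0, hcle⟩ : ∃ c, 0 < c ∧ ∀ y ∈ S ×ˢ sphere (0 : Vec n) 1,
      c ≤ inner ℝ y.2 (toEuclideanLin (A y.1) y.2) := by
    rcases (S ×ˢ sphere (0 : Vec n) 1).eq_empty_or_nonempty with h | h
    · exact ⟨1, one_pos, by simp [h]⟩
    · obtain ⟨y, hy, hmin⟩ := hT.exists_isMinOn h hcont.continuousOn
      refine ⟨_, inner_toEuclideanLin_self_pos (hA y.1) (ne_zero_of_mem_unit_sphere ⟨y.2, hy.2⟩),
        fun z hz => hmin hz⟩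
  refine ⟨c, hc0, fun x hx v => ?_⟩
  rcases eq_or_ne v 0 with rfl | hv
  · simp
  have hn : ‖v‖ ≠ 0 := norm_ne_zero_iff.2 hv
  have h := hcle (x, ‖v‖⁻¹ • v) ⟨hx, by simp [norm_smul, hn]⟩
  simp only [map_smul, inner_smul_left, inner_smul_right, conj_trivial] at h
  calc c * ‖v‖ ^ 2 ≤ (‖v‖⁻¹ * (‖v‖⁻¹ * inner ℝ v (toEuclideanLin (A x) v))) * ‖v‖ ^ 2 := by gcongr
    _ = _ := by field_simp

lemma hasGradientAt_half_inner_toEuclideanLin {A : Matrix (Fin n) (Fin n) ℝ} (hA : A.IsHermitian)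
    (v : Vec n) :
    HasGradientAt (fun w : Vec n => 1 / 2 * inner ℝ w (toEuclideanLin A w)) (toEuclideanLin A v) v := by
  have hL : HasFDerivAt (fun w => toEuclideanLin A w) (toEuclideanLin A).toContinuousLinearMap v :=
    (toEuclideanLin A).toContinuousLinearMap.hasFDerivAt
  rw [hasGradientAt_iff_hasFDerivAt]
  refine (((hasFDerivAt_id v).inner ℝ hL).const_mul (1 / 2)).congr_fderiv ?_
  ext w
  have h := inner_toEuclideanLin_comm hA v w
  have h2 := real_inner_comm (toEuclideanLin A v) w
  simp [fderivInnerCLM_apply] at h h2 ⊢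
  rw [← h, ← h2]
  ring

end MatrixFields

/-! ### The log-cosh potential and its saturated gradient. -/

section LogCosh

variable {n : ℕ}

/-- The potential `∑ᵢ (αᵢ / βᵢ) ln (cosh (βᵢ zᵢ))`. -/
noncomputable def logCosh (α β : Fin n → ℝ) (z : Vec n) : ℝ := ∑ i, α i / β i * Real.log (Real.cosh (β i * z i))

/-- The saturated vector with entries `αᵢ tanh (βᵢ zᵢ)`. -/
noncomputable def tanhVec (α β : Fin n → ℝ) (z : Vec n) : Vec n :=
  WithLp.toLp 2 fun i => α i * Real.tanh (β i * z i)

lemma Phic_eq_logCosh (α β : Fin n → ℝ) (qs q xc : Vec n) :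
    Phic α β qs q xc = logCosh α β (zc qs q xc) := rfl

lemma contDiff_tanh {r : WithTop ℕ∞} : ContDiff ℝ r Real.tanh := by
  rw [show Real.tanh = fun x => Real.sinh x / Real.cosh x from funext Real.tanh_eq_sinh_div_cosh]
  exact Real.contDiff_sinh.div Real.contDiff_cosh fun x => (Real.cosh_pos x).ne'

lemma contDiff_tanhVec {r : WithTop ℕ∞} (α β : Fin n → ℝ) : ContDiff ℝ r (tanhVec α β) :=
  contDiff_euclidean.2 fun i => contDiff_const.mul
    (contDiff_tanh.comp (contDiff_const.mul (contDiff_euclidean.1 contDiff_id i)))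

lemma contDiff_logCosh {r : WithTop ℕ∞} (α β : Fin n → ℝ) : ContDiff ℝ r (logCosh α β) :=
  ContDiff.sum fun i _ => contDiff_const.mul ((Real.contDiff_cosh.comp
    (contDiff_const.mul (contDiff_euclidean.1 contDiff_id i))).log fun _ => (Real.cosh_pos _).ne')

lemma hasGradientAt_logCosh (α : Fin n → ℝ) {β : Fin n → ℝ} (hβ : ∀ i, β i ≠ 0) (z : Vec n) :
    HasGradientAt (logCosh α β) (tanhVec α β z) z := by
  rw [hasGradientAt_iff_hasFDerivAt]
  have h : ∀ i, HasFDerivAt (fun z : Vec n => α i / β i * Real.log (Real.cosh (β i * z i)))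
      ((α i * Real.tanh (β i * z i)) • (EuclideanSpace.proj i : Vec n →L[ℝ] ℝ)) z := by
    intro i
    have h1 : HasDerivAt (fun x => α i / β i * Real.log (Real.cosh (β i * x)))
        (α i * Real.tanh (β i * z i)) (z i) := by
      have := ((((hasDerivAt_id (z i)).const_mul (β i)).cosh).log
        (Real.cosh_pos _).ne').const_mul (α i / β i)
      refine this.congr_deriv ?_
      rw [Real.tanh_eq_sinh_div_cosh]
      have := (Real.cosh_pos (β i * z i)).ne'
      have := hβ i
      simp only [id]
      field_simp
    exact HasDerivAt.comp_hasFDerivAt (f := fun z : Vec n => z i) z h1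
      (EuclideanSpace.proj i : Vec n →L[ℝ] ℝ).hasFDerivAt
  refine (HasFDerivAt.fun_sum fun i _ => h i).congr_fderiv ?_
  ext w
  simp [tanhVec, PiLp.inner_apply, mul_comm]

lemma logCosh_nonneg {α β : Fin n → ℝ} (hα : ∀ i, 0 < α i) (hβ : ∀ i, 0 < β i) (z : Vec n) :
    0 ≤ logCosh α β z :=
  Finset.sum_nonneg fun i _ => mul_nonneg (div_pos (hα i) (hβ i)).le
    (Real.log_nonneg (Real.one_le_cosh _))

lemma logCosh_term_le {α β : Fin n → ℝ} (hα : ∀ i, 0 < α i) (hβ : ∀ i, 0 < β i) (z : Vec n)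
    (i : Fin n) : α i / β i * Real.log (Real.cosh (β i * z i)) ≤ logCosh α β z :=
  Finset.single_le_sum (f := fun i => α i / β i * Real.log (Real.cosh (β i * z i)))
    (fun i _ => mul_nonneg (div_pos (hα i) (hβ i)).le (Real.log_nonneg (Real.one_le_cosh _)))
    (Finset.mem_univ i)

lemma logCosh_pos {α β : Fin n → ℝ} (hα : ∀ i, 0 < α i) (hβ : ∀ i, 0 < β i) {z : Vec n}
    (hz : z ≠ 0) : 0 < logCosh α β z := by
  obtain ⟨i, hi⟩ : ∃ i, z i ≠ 0 := by
    by_contra! h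
    exact hz (by ext i; exact h i)
  exact (mul_pos (div_pos (hα i) (hβ i)) (Real.log_pos (Real.one_lt_cosh.2
    (mul_ne_zero (hβ i).ne' hi)))).trans_le (logCosh_term_le hα hβ z i)

@[simp] lemma logCosh_zero (α β : Fin n → ℝ) : logCosh α β 0 = 0 := by simp [logCosh]

@[simp] lemma tanhVec_zero (α β : Fin n → ℝ) : tanhVec α β 0 = 0 := by
  ext i; simp [tanhVec]

lemma tanhVec_injective {α β : Fin n → ℝ} (hα : ∀ i, 0 < α i) (hβ : ∀ i, 0 < β i) :
    Function.Injective (tanhVec α β) := by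
  intro z w h
  ext i
  have h1 : α i * Real.tanh (β i * z i) = α i * Real.tanh (β i * w i) := congrArg (fun v : Vec n => v i) h
  exact mul_left_cancel₀ (hβ i).ne' (Real.tanh_injective (mul_left_cancel₀ (hα i).ne' h1))

/-- This is `exp |x| ≤ exp x + exp (-x) = 2 cosh x`; it gives the linear growth of the potential. -/
lemma abs_le_log_cosh_add (x : ℝ) : |x| ≤ Real.log (Real.cosh x) + Real.log 2 := by
  rw [← Real.log_mul (Real.cosh_pos x).ne' two_ne_zero, Real.le_log_iff_exp_le
    (mul_pos (Real.cosh_pos x) two_pos), Real.cosh_eq]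
  rcases abs_cases x with ⟨h, _⟩ | ⟨h, _⟩ <;> rw [h] <;>
    linarith [Real.exp_pos x, Real.exp_pos (-x)]

/-- The sublevel sets of `logCosh` are bounded. -/
lemma exists_norm_le_of_logCosh_le {α β : Fin n → ℝ} (hα : ∀ i, 0 < α i) (hβ : ∀ i, 0 < β i)
    (c : ℝ) : ∃ R, ∀ z : Vec n, logCosh α β z ≤ c → ‖z‖ ≤ R := by
  -- Each summand bounds `|z i|`: combine `(α i / β i) ln cosh (β i z i) ≤ c` with `β i |z i| ≤ ln
  -- cosh (β i z i) + ln 2`.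
  refine ⟨∑ i, (c / α i + Real.log 2 / β i), fun z hz => ?_⟩
  have hnorm : ‖z‖ ≤ ∑ i, |z i| := by
    have h : z = ∑ i, z i • EuclideanSpace.single i (1 : ℝ) := by
      ext k
      simp only [WithLp.ofLp_sum, Finset.sum_apply, PiLp.smul_apply, PiLp.single_apply, smul_eq_mul]
      simp
    calc ‖z‖ = ‖∑ i, z i • EuclideanSpace.single i (1 : ℝ)‖ := by rw [← h]
      _ ≤ ∑ i, ‖z i • EuclideanSpace.single i (1 : ℝ)‖ := norm_sum_le _ _
      _ = _ := by simp [norm_smul]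
  refine hnorm.trans (Finset.sum_le_sum fun i _ => ?_)
  have h1 := (logCosh_term_le hα hβ z i).trans hz
  have h2 := abs_le_log_cosh_add (β i * z i)
  rw [abs_mul, abs_of_pos (hβ i)] at h2
  have hα := hα i
  have hβ := hβ i
  have h3 : Real.log (Real.cosh (β i * z i)) ≤ c * β i / α i := by
    rw [le_div_iff₀ hα]
    rw [div_mul_eq_mul_div, div_le_iff₀ hβ] at h1
    linarith
  have h4 : |z i| ≤ (c * β i / α i + Real.log 2) / β i := by
    rw [le_div_iff₀ hβ]
    linarith
  refine h4.trans (le_of_eq ?_)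
  field_simp

end LogCosh

end PortHam

namespace PortHam

open Set Filter Topology Metric Matrix

/-! ### The kinetic energy and its derivatives. -/

section Kinetic

variable {n : ℕ} {M : Vec n → Matrix (Fin n) (Fin n) ℝ}

lemma contDiff_massInv (hMpos : ∀ q, (M q).PosDef) (hMreg : ∀ i j, ContDiff ℝ 2 fun q => M q i j)
    (i j : Fin n) : ContDiff ℝ 2 fun q => (M q)⁻¹ i j :=
  contDiff_matrix_inv hMreg (fun q => ((Matrix.isUnit_iff_isUnit_det _).1 (hMpos q).isUnit).ne_zero) i j

lemma contDiff_kinetic (hMpos : ∀ q, (M q).PosDef)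
    (hMreg : ∀ i j, ContDiff ℝ 2 fun q => M q i j) :
    ContDiff ℝ 2 fun y : Vec n × Vec n => kinetic M y.1 y.2 :=
  contDiff_const.mul (contDiff_snd.inner ℝ (contDiff_toEuclideanLin
    (fun i j => (contDiff_massInv hMpos hMreg i j).comp contDiff_fst) contDiff_snd))

lemma hasGradientAt_kinetic_right (hMpos : ∀ q, (M q).PosDef) (q p : Vec n) :
    HasGradientAt (fun p' => kinetic M q p') (toEuclideanLin (M q)⁻¹ p) p :=
  hasGradientAt_half_inner_toEuclideanLin (hMpos q).inv.isHermitian p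

/-- The gradient of the kinetic energy with respect to the position. -/
noncomputable def kineticForce (M : Vec n → Matrix (Fin n) (Fin n) ℝ) (q p : Vec n) : Vec n :=
  gradient (fun q' => kinetic M q' p) q

lemma contDiff_kinetic_left (hMpos : ∀ q, (M q).PosDef)
    (hMreg : ∀ i j, ContDiff ℝ 2 fun q => M q i j) (p : Vec n) :
    ContDiff ℝ 2 fun q => kinetic M q p :=
  ContDiff.comp (g := fun y : Vec n × Vec n => kinetic M y.1 y.2) (f := fun q => (q, p))
    (contDiff_kinetic hMpos hMreg) (contDiff_id.prodMk contDiff_const)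

lemma hasGradientAt_kinetic_left (hMpos : ∀ q, (M q).PosDef)
    (hMreg : ∀ i j, ContDiff ℝ 2 fun q => M q i j) (q p : Vec n) :
    HasGradientAt (fun q' => kinetic M q' p) (kineticForce M q p) q :=
  ((contDiff_kinetic_left hMpos hMreg p).differentiable (by simp) q).hasGradientAt

@[simp] lemma kineticForce_zero (q : Vec n) : kineticForce M q 0 = 0 := by
  simp [kineticForce, kinetic, gradient_fun_const]

/-- One derivative of the `C^2` mass matrix is spent here; the remaining one makes the closed-loop
field locally Lipschitz. -/
lemma contDiff_kineticForce (hMpos : ∀ q, (M q).PosDef)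
    (hMreg : ∀ i j, ContDiff ℝ 2 fun q => M q i j) :
    ContDiff ℝ 1 fun y : Vec n × Vec n => kineticForce M y.1 y.2 := by
  have h : ContDiff ℝ 1 fun y : Vec n × Vec n => fderiv ℝ (fun q' => kinetic M q' y.2) y.1 :=
    ContDiff.fderiv (m := 2) (f := fun (y : Vec n × Vec n) q' => kinetic M q' y.2)
      (ContDiff.comp (g := fun y : Vec n × Vec n => kinetic M y.1 y.2)
        (f := fun z : (Vec n × Vec n) × Vec n => (z.2, z.1.2)) (contDiff_kinetic hMpos hMreg)
        (contDiff_snd.prodMk (contDiff_snd.comp contDiff_fst)))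
      contDiff_fst (by norm_num [one_add_one_eq_two])
  exact (InnerProductSpace.toDual ℝ (Vec n)).symm.contDiff.comp h

/-- Joint differentiability is known, so the derivative is determined by its restrictions to the two
slices, which are the partial gradients. -/
lemma fderiv_kinetic (hMpos : ∀ q, (M q).PosDef)
    (hMreg : ∀ i j, ContDiff ℝ 2 fun q => M q i j) (q p v w : Vec n) :
    fderiv ℝ (fun y : Vec n × Vec n => kinetic M y.1 y.2) (q, p) (v, w) =
      inner ℝ (kineticForce M q p) v + inner ℝ (toEuclideanLin (M q)⁻¹ p) w := by
  have hd : HasFDerivAt (fun y : Vec n × Vec n => kinetic M y.1 y.2) _ (q, p) :=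
    ((contDiff_kinetic hMpos hMreg).differentiable (by simp) (q, p)).hasFDerivAt
  have h1 := (HasFDerivAt.comp (f := fun q' => (q', p)) q hd ((hasFDerivAt_id q).prodMk (hasFDerivAt_const p q))).unique
    (hasGradientAt_iff_hasFDerivAt.1 (hasGradientAt_kinetic_left hMpos hMreg q p))
  have h2 := (HasFDerivAt.comp (f := fun p' => (q, p')) p hd ((hasFDerivAt_const q p).prodMk (hasFDerivAt_id p))).unique
    (hasGradientAt_iff_hasFDerivAt.1 (hasGradientAt_kinetic_right hMpos q p))
  have h1' := DFunLike.congr_fun h1 v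
  have h2' := DFunLike.congr_fun h2 w
  simp only [ContinuousLinearMap.comp_apply, ContinuousLinearMap.prod_apply,
    ContinuousLinearMap.id_apply, _root_.zero_apply,
    InnerProductSpace.toDual_apply_apply] at h1' h2'
  rw [← h1', ← h2', ← map_add]
  simp

end Kinetic

/-! ### The closed loop: energy balance, properness and the LaSalle argument. -/

section ClosedLoop

variable {n : ℕ} {M : Vec n → Matrix (Fin n) (Fin n) ℝ} {V : Vec n → ℝ}
  {D : Vec n → Vec n → Matrix (Fin n) (Fin n) ℝ} {α β : Fin n → ℝ}
  {Rc Kc : Matrix (Fin n) (Fin n) ℝ} {qs : Vec n}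

lemma gradient_Phic (hβ : ∀ i, β i ≠ 0) (q xc : Vec n) :
    gradient (fun q' => Phic α β qs q' xc) q = tanhVec α β (zc qs q xc) := by
  refine HasGradientAt.gradient ?_
  have hz : HasFDerivAt (fun q' => zc qs q' xc) (ContinuousLinearMap.id ℝ (Vec n)) q :=
    ((hasFDerivAt_id q).sub_const qs).add_const xc
  rw [hasGradientAt_iff_hasFDerivAt]
  exact ((hasGradientAt_iff_hasFDerivAt.1 (hasGradientAt_logCosh α hβ (zc qs q xc))).comp q hz)

lemma ctrlLaw_eq (hβ : ∀ i, β i ≠ 0) (q xc : Vec n) :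
    ctrlLaw V α β qs q xc = gradient V q - tanhVec α β (zc qs q xc) := by
  rw [ctrlLaw, gradient_Phic hβ]

/-- The control law is saturated. -/
lemma abs_ctrlLaw_le (hα : ∀ i, 0 < α i) (hβ : ∀ i, β i ≠ 0) {C : ℝ} (hC : ∀ q, ‖gradient V q‖ ≤ C)
    (q xc : Vec n) (i : Fin n) : |ctrlLaw V α β qs q xc i| ≤ C + α i := by
  rw [ctrlLaw_eq hβ]
  refine (abs_sub _ _).trans (add_le_add ((PiLp.norm_apply_le (gradient V q) i).trans (hC q)) ?_)
  change |α i * Real.tanh _| ≤ α i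
  rw [abs_mul, abs_of_pos (hα i)]
  exact mul_le_of_le_one_right (hα i).le (Real.abs_tanh_lt_one _).le

/-- The gradient `∇_{x_c} (Φ_c + ½ x_cᵀ K_c x_c)`. -/
noncomputable def ctrlForce (α β : Fin n → ℝ) (Kc : Matrix (Fin n) (Fin n) ℝ) (qs q xc : Vec n) : Vec n :=
  tanhVec α β (zc qs q xc) + toEuclideanLin Kc xc

/-- The `∇V` of the Hamiltonian cancels that of the control law, so `V` disappears. In particular,
no Lipschitz condition on `∇V` is needed. -/
lemma closedLoop_eq (hMpos : ∀ q, (M q).PosDef) (hMreg : ∀ i j, ContDiff ℝ 2 fun q => M q i j)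
    (hVreg : ContDiff ℝ 1 V) (hβ : ∀ i, β i ≠ 0) (s : Vec n × Vec n × Vec n) :
    closedLoop M V D α β Rc Kc qs s =
      (toEuclideanLin (M s.1)⁻¹ s.2.1,
       -kineticForce M s.1 s.2.1 - toEuclideanLin (D s.1 s.2.1) (toEuclideanLin (M s.1)⁻¹ s.2.1)
         - tanhVec α β (zc qs s.1 s.2.2),
       -toEuclideanLin Rc (ctrlForce α β Kc qs s.1 s.2.2)) := by
  obtain ⟨q, p, xc⟩ := s
  have hp : gradient (fun p' => hamiltonian M V q p') p = toEuclideanLin (M q)⁻¹ p := by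
    refine HasGradientAt.gradient ?_
    rw [hasGradientAt_iff_hasFDerivAt]
    exact (hasGradientAt_iff_hasFDerivAt.1 (hasGradientAt_kinetic_right hMpos q p)).add_const _
  have hq : gradient (fun q' => hamiltonian M V q' p) q = kineticForce M q p + gradient V q := by
    refine HasGradientAt.gradient ?_
    rw [hasGradientAt_iff_hasFDerivAt, map_add]
    exact (hasGradientAt_iff_hasFDerivAt.1 (hasGradientAt_kinetic_left hMpos hMreg q p)).add
      (hasGradientAt_iff_hasFDerivAt.1 (hVreg.differentiable (by simp) q).hasGradientAt)
  simp only [closedLoop, mechField, hp, hq, ctrlLaw_eq hβ]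
  refine Prod.ext rfl (Prod.ext ?_ rfl)
  simp only [Matrix.toLpLin_one, LinearMap.id_apply]
  abel

lemma contDiff_zc {r : WithTop ℕ∞} :
    ContDiff ℝ r fun s : Vec n × Vec n × Vec n => zc qs s.1 s.2.2 :=
  (contDiff_fst.sub contDiff_const).add (contDiff_snd.comp contDiff_snd)

lemma locallyLipschitz_closedLoop (hMpos : ∀ q, (M q).PosDef)
    (hMreg : ∀ i j, ContDiff ℝ 2 fun q => M q i j) (hVreg : ContDiff ℝ 1 V)
    (hDreg : ∀ i j, LocallyLipschitz fun x : Vec n × Vec n => D x.1 x.2 i j) (hβ : ∀ i, β i ≠ 0) :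
    LocallyLipschitz (closedLoop M V D α β Rc Kc qs) := by
  rw [show closedLoop M V D α β Rc Kc qs = _ from funext (closedLoop_eq hMpos hMreg hVreg hβ)]
  have hqp : ContDiff ℝ 1 fun s : Vec n × Vec n × Vec n => (s.1, s.2.1) :=
    contDiff_fst.prodMk (contDiff_fst.comp contDiff_snd)
  have hvel : ContDiff ℝ 1 fun s : Vec n × Vec n × Vec n => toEuclideanLin (M s.1)⁻¹ s.2.1 :=
    contDiff_toEuclideanLin
      (fun i j => ContDiff.comp (g := fun q => (M q)⁻¹ i j)
        (f := fun s : Vec n × Vec n × Vec n => s.1)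
        ((contDiff_massInv hMpos hMreg i j).of_le (by norm_num)) contDiff_fst)
      (contDiff_fst.comp contDiff_snd)
  have htanh : ContDiff ℝ 1 fun s : Vec n × Vec n × Vec n => tanhVec α β (zc qs s.1 s.2.2) :=
    (contDiff_tanhVec α β).comp contDiff_zc
  have hspring : ContDiff ℝ 1 fun s : Vec n × Vec n × Vec n => toEuclideanLin Kc s.2.2 :=
    contDiff_toEuclideanLin (A := fun _ => Kc) (fun _ _ => contDiff_const)
      (contDiff_snd.comp contDiff_snd)
  have hforce' : ContDiff ℝ 1 fun s : Vec n × Vec n × Vec n => ctrlForce α β Kc qs s.1 s.2.2 :=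
    htanh.add hspring
  have hctrl : ContDiff ℝ 1 fun s : Vec n × Vec n × Vec n =>
      -toEuclideanLin Rc (ctrlForce α β Kc qs s.1 s.2.2) :=
    (contDiff_toEuclideanLin (A := fun _ => Rc) (fun _ _ => contDiff_const) hforce').neg
  have hforce : LocallyLipschitz fun s : Vec n × Vec n × Vec n => -kineticForce M s.1 s.2.1 :=
    (ContDiff.comp (g := fun y : Vec n × Vec n => kineticForce M y.1 y.2)
      (f := fun s : Vec n × Vec n × Vec n => (s.1, s.2.1))
      (contDiff_kineticForce hMpos hMreg) hqp).neg.locallyLipschitz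
  have hdamp : LocallyLipschitz fun s : Vec n × Vec n × Vec n =>
      toEuclideanLin (D s.1 s.2.1) (toEuclideanLin (M s.1)⁻¹ s.2.1) :=
    locallyLipschitz_toEuclideanLin
      (fun i j => LocallyLipschitz.comp (f := fun x : Vec n × Vec n => D x.1 x.2 i j)
        (g := fun s : Vec n × Vec n × Vec n => (s.1, s.2.1)) (hDreg i j) hqp.locallyLipschitz) hvel.locallyLipschitz
  exact hvel.locallyLipschitz.prodMk
    (((hforce.sub hdamp).sub htanh.locallyLipschitz).prodMk hctrl.locallyLipschitz)

lemma contDiff_Hd (hMpos : ∀ q, (M q).PosDef) (hMreg : ∀ i j, ContDiff ℝ 2 fun q => M q i j) :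
    ContDiff ℝ 2 (Hd M α β Kc qs) := by
  have hxc : ContDiff ℝ 2 fun s : Vec n × Vec n × Vec n => s.2.2 := contDiff_snd.comp contDiff_snd
  have hk : ContDiff ℝ 2 fun s : Vec n × Vec n × Vec n => kinetic M s.1 s.2.1 :=
    ContDiff.comp (g := fun y : Vec n × Vec n => kinetic M y.1 y.2)
      (f := fun s : Vec n × Vec n × Vec n => (s.1, s.2.1)) (contDiff_kinetic hMpos hMreg)
      (contDiff_fst.prodMk (contDiff_fst.comp contDiff_snd))
  exact (((contDiff_logCosh α β).comp contDiff_zc).add hk).add (contDiff_const.mul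
    (hxc.inner ℝ (contDiff_toEuclideanLin (fun _ _ => contDiff_const) hxc)))

lemma fderiv_Hd (hMpos : ∀ q, (M q).PosDef) (hMreg : ∀ i j, ContDiff ℝ 2 fun q => M q i j)
    (hβ : ∀ i, β i ≠ 0) (hKc : Kc.PosDef) (s v : Vec n × Vec n × Vec n) :
    fderiv ℝ (Hd M α β Kc qs) s v =
      inner ℝ (tanhVec α β (zc qs s.1 s.2.2)) (v.1 + v.2.2) +
      (inner ℝ (kineticForce M s.1 s.2.1) v.1 + inner ℝ (toEuclideanLin (M s.1)⁻¹ s.2.1) v.2.1) +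
      inner ℝ (toEuclideanLin Kc s.2.2) v.2.2 := by
  obtain ⟨q, p, xc⟩ := s
  obtain ⟨v, w, u⟩ := v
  have hq : HasFDerivAt (fun s : Vec n × Vec n × Vec n => s.1) _ (q, p, xc) :=
    hasFDerivAt_fst (𝕜 := ℝ)
  have hp : HasFDerivAt (fun s : Vec n × Vec n × Vec n => s.2.1) _ (q, p, xc) :=
    (hasFDerivAt_snd (𝕜 := ℝ)).fst
  have hx : HasFDerivAt (fun s : Vec n × Vec n × Vec n => s.2.2) _ (q, p, xc) :=
    (hasFDerivAt_snd (𝕜 := ℝ)).snd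
  have h1 := (hasGradientAt_iff_hasFDerivAt.1 (hasGradientAt_logCosh α hβ (zc qs q xc))).comp
    (q, p, xc) ((hq.sub_const qs).add hx)
  have h2 := HasFDerivAt.comp (g := fun y : Vec n × Vec n => kinetic M y.1 y.2) (q, p, xc)
    ((contDiff_kinetic hMpos hMreg).differentiable (by simp) (q, p)).hasFDerivAt (hq.prodMk hp)
  have h3 := (hasGradientAt_iff_hasFDerivAt.1
    (hasGradientAt_half_inner_toEuclideanLin hKc.isHermitian xc)).comp (q, p, xc) hx
  have h : HasFDerivAt (Hd M α β Kc qs) _ (q, p, xc) := (h1.add h2).add h3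
  rw [h.fderiv]
  simp only [_root_.add_apply, ContinuousLinearMap.comp_apply,
    ContinuousLinearMap.prod_apply, ContinuousLinearMap.coe_fst', ContinuousLinearMap.coe_snd',
    InnerProductSpace.toDual_apply_apply, fderiv_kinetic hMpos hMreg]

/-- The dissipation identity of the closed loop. -/
lemma fderiv_Hd_closedLoop (hMpos : ∀ q, (M q).PosDef)
    (hMreg : ∀ i j, ContDiff ℝ 2 fun q => M q i j) (hVreg : ContDiff ℝ 1 V)
    (hβ : ∀ i, β i ≠ 0) (hKc : Kc.PosDef) (s : Vec n × Vec n × Vec n) :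
    fderiv ℝ (Hd M α β Kc qs) s (closedLoop M V D α β Rc Kc qs s) =
      -inner ℝ (ctrlForce α β Kc qs s.1 s.2.2) (toEuclideanLin Rc (ctrlForce α β Kc qs s.1 s.2.2)) -
      inner ℝ (toEuclideanLin (M s.1)⁻¹ s.2.1)
        (toEuclideanLin (D s.1 s.2.1) (toEuclideanLin (M s.1)⁻¹ s.2.1)) := by
  rw [closedLoop_eq hMpos hMreg hVreg hβ, fderiv_Hd hMpos hMreg hβ hKc]
  set t := tanhVec α β (zc qs s.1 s.2.2) with ht
  set v := toEuclideanLin (M s.1)⁻¹ s.2.1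
  have hw : ∀ u, inner ℝ (ctrlForce α β Kc qs s.1 s.2.2) u =
      inner ℝ t u + inner ℝ (toEuclideanLin Kc s.2.2) u := fun u => inner_add_left _ _ _
  rw [hw]
  simp only [inner_add_right, inner_sub_right, inner_neg_right]
  -- With the inner products in a common order, the exchange terms of `v` with `t` and with
  -- `kineticForce` cancel in pairs.
  rw [real_inner_comm v t, real_inner_comm v (kineticForce M s.1 s.2.1)]
  ring

lemma kinetic_nonneg (hMpos : ∀ q, (M q).PosDef) (q p : Vec n) : 0 ≤ kinetic M q p :=
  mul_nonneg (by norm_num) (inner_toEuclideanLin_self_nonneg (hMpos q).inv.posSemidef p)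

lemma isLyapunovFunction_Hd (hMpos : ∀ q, (M q).PosDef)
    (hMreg : ∀ i j, ContDiff ℝ 2 fun q => M q i j) (hVreg : ContDiff ℝ 1 V)
    (hDpos : ∀ q p, (D q p).PosSemidef) (hα : ∀ i, 0 < α i) (hβ : ∀ i, 0 < β i)
    (hRc : Rc.PosSemidef) (hKc : Kc.PosDef) :
    IsLyapunovFunction (closedLoop M V D α β Rc Kc qs) (qs, 0, 0) (Hd M α β Kc qs) where
  contDiff := (contDiff_Hd hMpos hMreg).of_le (by norm_num)
  zero_at := by simp [Hd, Phic_eq_logCosh, zc, kinetic]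
  pos_of_ne := by
    rintro ⟨q, p, xc⟩ hne
    have h1 := logCosh_nonneg hα hβ (zc qs q xc)
    have h2 := kinetic_nonneg hMpos q p
    have h3 := inner_toEuclideanLin_self_nonneg hKc.posSemidef xc
    change 0 < logCosh α β (zc qs q xc) + kinetic M q p + 1 / 2 * inner ℝ xc (toEuclideanLin Kc xc)
    by_cases hx : xc = 0
    · by_cases hp : p = 0
      · have hq : zc qs q xc ≠ 0 := by
          rintro h
          simp only [zc, hx, add_zero, sub_eq_zero] at h
          exact hne (by rw [h, hp, hx])
        linarith [logCosh_pos hα hβ hq]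
      · have : 0 < kinetic M q p :=
          mul_pos (by norm_num) (inner_toEuclideanLin_self_pos (hMpos q).inv hp)
        linarith
    · linarith [inner_toEuclideanLin_self_pos hKc hx]
  deriv_nonpos s := by
    rw [fderiv_Hd_closedLoop hMpos hMreg hVreg (fun i => (hβ i).ne') hKc]
    have h1 := inner_toEuclideanLin_self_nonneg hRc (ctrlForce α β Kc qs s.1 s.2.2)
    have h2 := inner_toEuclideanLin_self_nonneg (hDpos s.1 s.2.1) (toEuclideanLin (M s.1)⁻¹ s.2.1)
    linarith

lemma norm_le_sqrt_of_mul_sq_le {v : Vec n} {c b : ℝ} (hc : 0 < c) (h : c * ‖v‖ ^ 2 ≤ b) :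
    ‖v‖ ≤ √(b / c) :=
  Real.le_sqrt_of_sq_le (by rwa [le_div_iff₀' hc])

/-- `M⁻¹` need not be uniformly positive definite on all of `ℝⁿ`, so the order of the bounds
matters: `Φ_c` bounds `z_c`, the spring energy bounds `x_c`, hence `q = z_c - x_c + q_*` lies in a
fixed ball. On that ball `M⁻¹` has a uniform lower bound `m`, which bounds `p`. -/
lemma isRadiallyUnbounded_Hd (hMpos : ∀ q, (M q).PosDef)
    (hMreg : ∀ i j, ContDiff ℝ 2 fun q => M q i j) (hα : ∀ i, 0 < α i) (hβ : ∀ i, 0 < β i)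
    (hKc : Kc.PosDef) : IsRadiallyUnbounded (Hd M α β Kc qs) := by
  refine tendsto_atTop.2 fun c => ?_
  obtain ⟨R₁, hR₁⟩ := exists_norm_le_of_logCosh_le hα hβ c
  obtain ⟨k, hk0, hk⟩ := exists_forall_le_inner_toEuclideanLin (E := Vec n) (A := fun _ => Kc)
    (fun _ => hKc) (fun _ _ => contDiff_const) (isCompact_singleton (x := 0))
  obtain ⟨m, hm0, hm⟩ := exists_forall_le_inner_toEuclideanLin (fun q => (hMpos q).inv)
    (fun i j => (contDiff_massInv hMpos hMreg i j).of_le (by norm_num))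
    (isCompact_closedBall (0 : Vec n) (R₁ + √(2 * c / k) + ‖qs‖))
  have hb : Bornology.IsBounded {s : Vec n × Vec n × Vec n | Hd M α β Kc qs s < c} := by
    refine isBounded_iff_forall_norm_le.2
      ⟨max (R₁ + √(2 * c / k) + ‖qs‖) (max √(2 * c / m) √(2 * c / k)), ?_⟩
    rintro ⟨q, p, xc⟩ hs
    have h1 := logCosh_nonneg hα hβ (zc qs q xc)
    have h2 := kinetic_nonneg hMpos q p
    have h3 := inner_toEuclideanLin_self_nonneg hKc.posSemidef xc
    have hs' : logCosh α β (zc qs q xc) + kinetic M q p +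
      1 / 2 * inner ℝ xc (toEuclideanLin Kc xc) < c := hs
    have hz : ‖zc qs q xc‖ ≤ R₁ := hR₁ _ (by linarith)
    have hx : ‖xc‖ ≤ √(2 * c / k) := norm_le_sqrt_of_mul_sq_le hk0
      ((hk 0 rfl xc).trans (by linarith))
    have hq : ‖q‖ ≤ R₁ + √(2 * c / k) + ‖qs‖ := by
      have : q = zc qs q xc - xc + qs := by simp [zc]
      calc ‖q‖ = ‖zc qs q xc - xc + qs‖ := by rw [← this]
        _ ≤ ‖zc qs q xc‖ + ‖xc‖ + ‖qs‖ := (norm_add_le _ _).trans (by gcongr; exact norm_sub_le _ _)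
        _ ≤ _ := by gcongr
    have hp : ‖p‖ ≤ √(2 * c / m) := norm_le_sqrt_of_mul_sq_le hm0
      ((hm q (by simpa using hq) p).trans (by unfold kinetic at hs'; linarith))
    exact max_le_max hq (max_le_max hp hx)
  filter_upwards [Bornology.isBounded_def.1 hb] with s hs
  simpa using hs

/-- A curve on `[0, ∞)` with vanishing derivative is constant. -/
lemma eq_of_hasDerivWithinAt_zero {X : Type*} [NormedAddCommGroup X] [NormedSpace ℝ X]
    {x : ℝ → X} (hx : ∀ t ∈ Ici (0 : ℝ), HasDerivWithinAt x 0 (Ici 0) t) {t : ℝ} (ht : 0 ≤ t) :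
    x t = x 0 := by
  have h := (convex_Ici (0 : ℝ)).norm_image_sub_le_of_norm_hasDerivWithin_le (C := 0) hx
    (fun _ _ => by simp) self_mem_Ici (show t ∈ Ici 0 from ht)
  rw [zero_mul] at h
  exact sub_eq_zero.1 (norm_le_zero_iff.1 h)

/-- The derivative of a curve that is constant on `[0, ∞)` vanishes. -/
lemma eq_zero_of_hasDerivWithinAt_of_const {X : Type*} [NormedAddCommGroup X] [NormedSpace ℝ X]
    {x : ℝ → X} (hc : ∀ t, 0 ≤ t → x t = x 0) {t : ℝ} (ht : 0 ≤ t) {x' : X}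
    (hx : HasDerivWithinAt x x' (Ici 0) t) : x' = 0 :=
  (uniqueDiffOn_Ici 0 t ht).eq_deriv _ hx
    ((hasDerivWithinAt_const t (Ici 0) (x 0)).congr (fun s hs => hc s hs) (hc t ht))

/-- `H_d` is constant along no solution of the closed loop except the equilibrium. -/
lemma eq_equilibrium_of_Hd_const (hMpos : ∀ q, (M q).PosDef)
    (hMreg : ∀ i j, ContDiff ℝ 2 fun q => M q i j) (hVreg : ContDiff ℝ 1 V)
    (hDpos : ∀ q p, (D q p).PosSemidef) (hα : ∀ i, 0 < α i) (hβ : ∀ i, 0 < β i)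
    (hRc : Rc.PosDef) (hKc : Kc.PosDef) {y : ℝ → Vec n × Vec n × Vec n}
    (hy : IsIntegralCurveOn y (fun _ => closedLoop M V D α β Rc Kc qs) (Ici 0))
    (hc : ∀ t, 0 ≤ t → Hd M α β Kc qs (y t) = Hd M α β Kc qs (y 0)) : y 0 = (qs, 0, 0) := by
  have hβ' : ∀ i, β i ≠ 0 := fun i => (hβ i).ne'
  -- Both dissipation terms have the same sign and sum to zero; definiteness of `Rc` annihilates
  -- `ctrlForce`, while the semidefinite `D` gives no information on `p`.
  have hw : ∀ t, 0 ≤ t → ctrlForce α β Kc qs (y t).1 (y t).2.2 = 0 := by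
    intro t ht
    by_contra hne
    have h := eq_zero_of_hasDerivWithinAt_of_const (x := fun t => Hd M α β Kc qs (y t)) hc ht
      (((contDiff_Hd hMpos hMreg).differentiable (by simp) (y t)).hasFDerivAt.comp_hasDerivWithinAt t
        (hy t ht))
    rw [fderiv_Hd_closedLoop hMpos hMreg hVreg hβ' hKc] at h
    linarith [inner_toEuclideanLin_self_pos hRc hne, inner_toEuclideanLin_self_nonneg
      (hDpos (y t).1 (y t).2.1) (toEuclideanLin (M (y t).1)⁻¹ (y t).2.1)]
  have hder : ∀ t, 0 ≤ t → HasDerivWithinAt y _ (Ici 0) t := fun t ht => hy t ht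
  simp only [closedLoop_eq hMpos hMreg hVreg hβ'] at hder
  have hx : ∀ t, 0 ≤ t → (y t).2.2 = (y 0).2.2 := fun t ht =>
    eq_of_hasDerivWithinAt_zero (x := fun t => (y t).2.2) (fun s hs => by
      have := (hder s hs).snd.snd
      rwa [hw s hs, map_zero, neg_zero] at this) ht
  have hz : ∀ t, 0 ≤ t → tanhVec α β (zc qs (y t).1 (y t).2.2) = -toEuclideanLin Kc (y 0).2.2 :=
    fun t ht => by
      rw [← hx t ht]
      exact eq_neg_of_add_eq_zero_left (hw t ht)
  have hq : ∀ t, 0 ≤ t → (y t).1 = (y 0).1 := fun t ht => by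
    have h := tanhVec_injective hα hβ ((hz t ht).trans (hz 0 le_rfl).symm)
    rw [hx t ht] at h
    simpa [zc] using h
  have hp : ∀ t, 0 ≤ t → (y t).2.1 = 0 := fun t ht =>
    eq_zero_of_toEuclideanLin_eq_zero (hMpos (y t).1).inv
      (eq_zero_of_hasDerivWithinAt_of_const (x := fun t => (y t).1) hq ht (hder t ht).fst)
  -- With `p = 0` identically, the kinetic and damping forces vanish, so the momentum equation
  -- reduces to `tanhVec = 0`.
  have hp0 := eq_zero_of_hasDerivWithinAt_of_const (x := fun t => (y t).2.1)
    (fun t ht => (hp t ht).trans (hp 0 le_rfl).symm) le_rfl (hder 0 le_rfl).snd.fst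
  simp only [hp 0 le_rfl, kineticForce_zero, map_zero, neg_zero, sub_zero, zero_sub,
    neg_eq_zero] at hp0
  have hx0 : (y 0).2.2 = 0 := eq_zero_of_toEuclideanLin_eq_zero hKc (by
    have := hz 0 le_rfl
    rw [hp0] at this
    exact neg_eq_zero.1 this.symm)
  have hz0 : zc qs (y 0).1 (y 0).2.2 = 0 :=
    tanhVec_injective hα hβ (hp0.trans (tanhVec_zero α β).symm)
  rw [zc, hx0, add_zero, sub_eq_zero] at hz0
  exact Prod.ext hz0 (Prod.ext (hp 0 le_rfl) hx0)

lemma closedLoop_equilibrium (hMpos : ∀ q, (M q).PosDef)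
    (hMreg : ∀ i j, ContDiff ℝ 2 fun q => M q i j) (hVreg : ContDiff ℝ 1 V) (hβ : ∀ i, β i ≠ 0) :
    closedLoop M V D α β Rc Kc qs (qs, 0, 0) = 0 := by
  rw [closedLoop_eq hMpos hMreg hVreg hβ]
  simp [ctrlForce, zc]

end ClosedLoop

end PortHam

theorem mainTheorem4 (n : ℕ)
    (M : PortHam.Vec n → Matrix (Fin n) (Fin n) ℝ)
    (V : PortHam.Vec n → ℝ)
    (D : PortHam.Vec n → PortHam.Vec n → Matrix (Fin n) (Fin n) ℝ)
    (hMpos : ∀ q, (M q).PosDef)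
    (hMreg : ∀ i j, ContDiff ℝ 2 (fun q => M q i j))
    (hVreg : ContDiff ℝ 1 V)
    (hDdiag : ∀ q p, (D q p).IsDiag)
    (hDpos : ∀ q p, (D q p).PosSemidef)
    (hDreg : ∀ i j, LocallyLipschitz (fun x : PortHam.Vec n × PortHam.Vec n => D x.1 x.2 i j))
    (C : ℝ) (hC : ∀ q, ‖gradient V q‖ ≤ C)
    (α β : Fin n → ℝ) (hα : ∀ i, 0 < α i) (hβ : ∀ i, 0 < β i)
    (Rc Kc : Matrix (Fin n) (Fin n) ℝ) (hRc : Rc.PosDef) (hKc : Kc.PosDef)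
    (qs : PortHam.Vec n) :
    (∀ q xc i, |PortHam.ctrlLaw V α β qs q xc i| ≤ C + α i) ∧
    PortHam.IsGloballyAsymptoticallyStable
      (PortHam.closedLoop M V D α β Rc Kc qs) (qs, 0, 0) ∧
    PortHam.IsLyapunovFunction
      (PortHam.closedLoop M V D α β Rc Kc qs) (qs, 0, 0) (PortHam.Hd M α β Kc qs) ∧
    PortHam.IsRadiallyUnbounded (PortHam.Hd M α β Kc qs) := by
  have hβ' : ∀ i, β i ≠ 0 := fun i => (hβ i).ne'
  have hL := PortHam.isLyapunovFunction_Hd (qs := qs) hMpos hMreg hVreg hDpos hα hβ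
    hRc.posSemidef hKc
  have hr := PortHam.isRadiallyUnbounded_Hd (qs := qs) hMpos hMreg hα hβ hKc
  exact ⟨PortHam.abs_ctrlLaw_le hα hβ' hC, PortHam.isGloballyAsymptoticallyStable_of_laSalle
    (PortHam.locallyLipschitz_closedLoop hMpos hMreg hVreg hDreg hβ')
    (PortHam.closedLoop_equilibrium hMpos hMreg hVreg hβ') hL hr
    (fun _ hy hc => PortHam.eq_equilibrium_of_Hd_const hMpos hMreg hVreg hDpos hα hβ hRc hKc hy hc),
    hL, hr⟩
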